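/- Let $d$ and $m$ be non-negative integers. Let $\mathcal{S}=\{S_k\le \mathrm{Sym}(m_k)\}_{k\ge 1}$ be a sequence of finite transitive permutation groups such that each $S_k$ is perfect and can be generated by at most $d$ elements. Suppose that for every $k$ there exist points $i,j\in\{1,\dots,m_k\}$ with $\mathrm{St}_{S_k}(i)\neq \mathrm{St}_{S_k}(j)$. For permutation groups $A\le \mathrm{Sym}(X)$ and $B\le\mathrm{Sym}(Y)$, the wreath product $A^{Y}\rtimes B$ is regarded as a permutation group in two ways: on $X\times Y$ with the permutational wreath action, denoted $A\wr B$, and on $X^{Y}$ with the product action, denoted $A\odot B$ and called the exponentiation of $A$ by $B$. Let $k_1<k_2<\cdots$ be a strictly increasing sequence of positive integers with $k_{n+1}-k_n\le m$ for every $n\ge 1$. Define $G_1=S_1$ and, for $i\ge 1$, $G_{i+1}=S_{i+1}\odot G_i$ if $i+1\in\{k_n : n\ge 1\}$, and $G_{i+1}=S_{i+1}\wr G_i$ otherwise. Let $G=\varprojlim G_n$ be the inverse limit along the natural projections $G_{n+1}\to G_n$ (an infinitely iterated mixed wreath product of type $(\mathcal{S},\{k_n\})$ with stride at most $m$), with its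 profinite topology. Then $G$ is topologically finitely generated; more precisely, $G$ has a dense subgroup generated by at most $2md$ elements. -/

import Mathlib

namespace MixedWreath

/-- A group `Elem` together with an action on a set `Point`. -/
structure PermGroup where
  Point : Type
  Elem : Type
  [group : Group Elem]
  [action : MulAction Elem Point]

attribute [instance] PermGroup.group PermGroup.action

/-- The permutation group given by a subgroup `S` of `Sym(r)`, with its natural action. -/
def ofSubgroup {r : ℕ} (S : Subgroup (Equiv.Perm (Fin r))) : PermGroup where
  Point := Fin r
  Elem := S

/-- The abstract wreath product `A ≀ B = A ^ Ω ⋊ B`, where `Ω` is the set on which `B` acts and `B`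
permutes the coordinates: `(b • f) w = f (b⁻¹ • w)`. -/
abbrev Wreath (A B : PermGroup) : Type :=
  (B.Point → A.Elem) ⋊[mulAutArrow] B.Elem

/-- The permutational wreath product of `A` by `B`: the wreath product acting on the product of the
set of `A` with the set of `B`. -/
def permutational (A B : PermGroup) : PermGroup where
  Point := A.Point × B.Point
  Elem := Wreath A B
  action :=
    { smul := fun g p => (g.left (g.right • p.2) • p.1, g.right • p.2)
      one_smul := fun p => by
        change ((1 : A.Elem) • p.1, (1 : B.Elem) • p.2) = p
        simp
      mul_smul := fun g h p => by
        change ((g.left ((g.right * h.right) • p.2) *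
            h.left (g.right⁻¹ • (g.right * h.right) • p.2)) • p.1, (g.right * h.right) • p.2) =
          (g.left (g.right • h.right • p.2) • h.left (h.right • p.2) • p.1,
            g.right • h.right • p.2)
        simp [mul_smul] }

/-- The exponentiation of `A` by `B`: the wreath product with the product action, on the set of
functions from the set of `B` to the set of `A`. -/
def exponentiation (A B : PermGroup) : PermGroup where
  Point := B.Point → A.Point
  Elem := Wreath A B
  action :=
    { smul := fun g p w => g.left w • p (g.right⁻¹ • w)
      one_smul := fun p => by
        funext w
        change (1 : A.Elem) • p ((1 : B.Elem)⁻¹ • w) = p w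
        simp
      mul_smul := fun g h p => by
        funext w
        change (g.left w * h.left (g.right⁻¹ • w)) • p ((g.right * h.right)⁻¹ • w) =
          g.left w • h.left (g.right⁻¹ • w) • p (h.right⁻¹ • g.right⁻¹ • w)
        simp [mul_smul] }

/-- The two ways of regarding a wreath product as a permutation group. -/
inductive Kind
  | permutational
  | exponentiation

/-- The wreath product of `A` by `B` with the action of the given kind. -/
def wreath : Kind → PermGroup → PermGroup → PermGroup
  | .permutational, A, B => permutational A B
  | .exponentiation, A, B => exponentiation A B

/-- The projection of a wreath product `A ^ Ω ⋊ B` onto `B`. -/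
def wreathProj : (κ : Kind) → (A B : PermGroup) → (wreath κ A B).Elem →* B.Elem
  | .permutational, A, B => (SemidirectProduct.rightHom : Wreath A B →* B.Elem)
  | .exponentiation, A, B => (SemidirectProduct.rightHom : Wreath A B →* B.Elem)

open Classical in
/-- The action used in the step with index `i`: exponentiation exactly when `i` is one of the
`k n`. -/
noncomputable def kindAt (k : ℕ → ℕ) (i : ℕ) : Kind :=
  if i ∈ Set.range k then .exponentiation else .permutational

variable {r : ℕ → ℕ}

/-- The iterated mixed wreath products of type `(S, k)`. All sequences are indexed from `0`, so that
the first group is `S 0`. -/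
noncomputable def iterated (S : (i : ℕ) → Subgroup (Equiv.Perm (Fin (r i)))) (k : ℕ → ℕ) :
    ℕ → PermGroup
  | 0 => ofSubgroup (S 0)
  | i + 1 => wreath (kindAt k (i + 1)) (ofSubgroup (S (i + 1))) (iterated S k i)

/-- The projection from each iterated mixed wreath product to the preceding one. -/
noncomputable def proj (S : (i : ℕ) → Subgroup (Equiv.Perm (Fin (r i)))) (k : ℕ → ℕ) (i : ℕ) :
    (iterated S k (i + 1)).Elem →* (iterated S k i).Elem :=
  wreathProj (kindAt k (i + 1)) (ofSubgroup (S (i + 1))) (iterated S k i)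

/-- The (finite) groups of the inverse system carry the discrete topology. -/
instance (P : PermGroup) : TopologicalSpace P.Elem := ⊥

instance (P : PermGroup) : DiscreteTopology P.Elem := ⟨rfl⟩

/-- The infinitely iterated mixed wreath product of type `(S, k)`: the inverse limit of the iterated
mixed wreath products along the projections, inside their direct product. As a subgroup of the
product it carries the subspace topology of the product topology. -/
noncomputable def infinite (S : (i : ℕ) → Subgroup (Equiv.Perm (Fin (r i)))) (k : ℕ → ℕ) :
    Subgroup ((i : ℕ) → (iterated S k i).Elem) where
  carrier := {g | ∀ i, proj S k i (g (i + 1)) = g i}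
  one_mem' := fun i => by simp
  mul_mem' := fun {g h} hg hh i => by simp [hg i, hh i]
  inv_mem' := fun {g} hg i => by simp [hg i]

/-- The group `G` can be generated by at most `n` elements. -/
def GeneratedByAtMost (G : Type*) [Group G] (n : ℕ) : Prop :=
  ∃ s : Finset G, s.card ≤ n ∧ Subgroup.closure (s : Set G) = ⊤

/-- The topological group `G` can be topologically generated by at most `n` elements, i.e. at most
`n` elements generate a dense subgroup. -/
def TopologicallyGeneratedByAtMost (G : Type*) [Group G] [TopologicalSpace G] (n : ℕ) : Prop :=
  ∃ s : Finset G, s.card ≤ n ∧ Dense (Subgroup.closure (s : Set G) : Set G)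

end MixedWreath

/-! Let `B` be perfect, let `G` act transitively on `Ω`, let `H ≤ B^Ω ⋊ G` be generated by lifts of
generators of `G`, and let `M` be the part of `H` in the base group. Suitable commutators in `H`
make all coordinate projections of `M` surjective. A Goursat argument then gives `M = B^Ω` unless
two coordinates are linked, i.e. share a nontrivial quotient of `M` (`eq_top_of_not_linked`). Links
are preserved by `G` and spread by point stabilizers (`LinkRel`). A link is excluded by an element
of `H` that fixes both points, with a normal generator of `B` as one coordinate and `1` as the other
(`not_linked`). Hence lifting works once one block of `d` generators acts suitably on `Ω`
(`closure_lift_eq_top`).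

Two kinds of blocks are suitable. The lift of a directed block is again directed for the
permutational action, so a single block serves until the first exponentiation. Exponentiation turns
every trivially lifted block into a separating one (`separating_exponentiation`); this is where
points with different stabilizers are needed. A separating block pays for one lift, while the unused
ones remain separating through permutational steps. As exponentiations are at most `m` steps apart,
`m` blocks suffice between two of them. The other `m` blocks are lifted trivially at the next
exponentiation and take over there. The two families alternate, which accounts for the `2 * m * d`
generators. -/

namespace MixedWreath

open scoped commutatorElement

/-! ### Normal generators of finite perfect groups. -/

section NormalGeneration

variable {B : Type*} [Group B]

theorem eq_top_of_commutators_mem (hB : Group.IsPerfect B) (R : Subgroup B) [R.Normal]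
    (h : ∀ a b : B, ⁅a, b⁆ ∈ R) : R = ⊤ := by
  have h1 : commutator B ≤ R := Subgroup.commutator_le.2 fun a _ b _ => h a b
  rw [Group.isPerfect_def.1 hB] at h1
  exact top_le_iff.1 h1

theorem sup_eq_top_of_maximal {I R : Subgroup B} (hI : I.Normal)
    (hR : Maximal (fun N : Subgroup B => N.Normal ∧ N ≠ ⊤) R) (h : ¬ I ≤ R) : I ⊔ R = ⊤ := by
  have := hI
  have := hR.prop.1
  by_contra h'
  exact h (le_sup_left.trans (hR.le_of_ge ⟨Subgroup.sup_normal I R, h'⟩ le_sup_right))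

/-- In a perfect group maximal normal subgroups are prime with respect to intersections. -/
theorem not_inf_le_of_maximal (hB : Group.IsPerfect B) {I J R : Subgroup B} (hI : I.Normal)
    (hJ : J.Normal) (hR : Maximal (fun N : Subgroup B => N.Normal ∧ N ≠ ⊤) R)
    (h1 : ¬ I ≤ R) (h2 : ¬ J ≤ R) : ¬ I ⊓ J ≤ R := by
  intro h
  have := hR.prop.1
  apply hR.prop.2
  apply eq_top_of_commutators_mem hB
  intro a b
  have ha : a ∈ I ⊔ R := by rw [sup_eq_top_of_maximal hI hR h1]; trivial
  have hb : b ∈ J ⊔ R := by rw [sup_eq_top_of_maximal hJ hR h2]; trivial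
  obtain ⟨i, hi, s, hs, rfl⟩ := Subgroup.mem_sup_of_normal_right.1 ha
  obtain ⟨j, hj, u, hu, rfl⟩ := Subgroup.mem_sup_of_normal_right.1 hb
  have hij : ⁅i, j⁆ ∈ R :=
    h (Subgroup.commutator_le_inf I J (Subgroup.commutator_mem_commutator hi hj))
  rw [← QuotientGroup.eq_one_iff] at hs hu hij ⊢
  simp only [commutatorElement_def, QuotientGroup.mk_mul, QuotientGroup.mk_inv] at hij ⊢
  rw [hs, hu, mul_one, mul_one, hij]

/-- By primality, an intersection of finitely many maximal normal subgroups lies in no further one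
`R`. Multiplying `g` by an element of the intersection outside `R` moves it out of `R` without
changing its cosets modulo the others. -/
theorem exists_notMem_maximal_normal (hB : Group.IsPerfect B) (F : Finset (Subgroup B))
    (hF : ∀ R ∈ F, Maximal (fun N : Subgroup B => N.Normal ∧ N ≠ ⊤) R) :
    ∃ g : B, ∀ R ∈ F, g ∉ R := by
  classical
  have key : ∀ (F : Finset (Subgroup B)) (R : Subgroup B),
      (∀ N ∈ F, Maximal (fun N : Subgroup B => N.Normal ∧ N ≠ ⊤) N) →
      Maximal (fun N : Subgroup B => N.Normal ∧ N ≠ ⊤) R → R ∉ F →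
      (F.inf id).Normal ∧ ¬ F.inf id ≤ R := by
    intro F R hF hR hRF
    induction F using Finset.induction_on with
    | empty =>
      refine ⟨by simp, ?_⟩
      simpa using hR.prop.2
    | insert N F _ ih =>
      obtain ⟨ih1, ih2⟩ := ih (fun N hN => hF N (Finset.mem_insert_of_mem hN))
        (fun h => hRF (Finset.mem_insert_of_mem h))
      have hN := hF N (Finset.mem_insert_self _ _)
      have hNn := hN.prop.1
      rw [Finset.inf_insert, id]
      refine ⟨Subgroup.normal_inf_normal N (F.inf id), ?_⟩
      refine not_inf_le_of_maximal hB hNn ih1 hR (fun h => hRF ?_) ih2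
      rw [← hN.eq_of_le hR.prop h]
      exact Finset.mem_insert_self _ _
  induction F using Finset.induction_on with
  | empty => exact ⟨1, by simp⟩
  | insert R F hRF ih =>
    obtain ⟨g, hg⟩ := ih fun N hN => hF N (Finset.mem_insert_of_mem hN)
    by_cases hgR : g ∈ R
    · obtain ⟨-, h⟩ := key F R (fun N hN => hF N (Finset.mem_insert_of_mem hN))
        (hF R (Finset.mem_insert_self _ _)) hRF
      obtain ⟨x, hx, hxR⟩ := SetLike.not_le_iff_exists.1 h
      refine ⟨g * x, fun N hN => ?_⟩
      rcases Finset.mem_insert.1 hN with rfl | hN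
      · rwa [Subgroup.mul_mem_cancel_left _ hgR]
      · have hxN : x ∈ N := (Finset.inf_le hN : F.inf id ≤ id N) hx
        rw [Subgroup.mul_mem_cancel_right _ hxN]
        exact hg N hN
    · refine ⟨g, fun N hN => ?_⟩
      rcases Finset.mem_insert.1 hN with rfl | hN
      · exact hgR
      · exact hg N hN

/-- A finite perfect group is the normal closure of one element. -/
theorem exists_normalClosure_singleton_eq_top [Finite B] (hB : Group.IsPerfect B) :
    ∃ g : B, Subgroup.normalClosure {g} = ⊤ := by
  obtain ⟨g, hg⟩ := exists_notMem_maximal_normal hB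
    (Set.toFinite {R | Maximal (fun N : Subgroup B => N.Normal ∧ N ≠ ⊤) R}).toFinset (by simp)
  refine ⟨g, ?_⟩
  by_contra h
  obtain ⟨R, hle, hR⟩ := Set.Finite.exists_le_maximal
    (Set.toFinite {N : Subgroup B | N.Normal ∧ N ≠ ⊤})
    (show Subgroup.normalClosure {g} ∈ {N : Subgroup B | N.Normal ∧ N ≠ ⊤} from
      ⟨Subgroup.normalClosure_normal, h⟩)
  exact hg R (by simpa using hR) (hle (Subgroup.subset_normalClosure rfl))

end NormalGeneration

/-! ### Subgroups of a wreath product and linked coordinates. -/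

section WreathSubgroups

variable {Ω B G : Type*} [Group B] [Group G] [MulAction G Ω]

theorem left_mul_apply (a b : (Ω → B) ⋊[mulAutArrow] G) (p : Ω) :
    (a * b).left p = a.left p * b.left (a.right⁻¹ • p) := rfl

theorem left_inv_apply (a : (Ω → B) ⋊[mulAutArrow] G) (p : Ω) :
    (a⁻¹).left p = (a.left (a.right • p))⁻¹ := by
  have h := congrArg (fun x => x.left p) (inv_mul_cancel a)
  simp only [left_mul_apply, SemidirectProduct.inv_right, inv_inv, SemidirectProduct.one_left,
    Pi.one_apply] at h
  exact eq_inv_of_mul_eq_one_left h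

/-- The part of a subgroup of a wreath product that lies in the base group. -/
def basePart (H : Subgroup ((Ω → B) ⋊[mulAutArrow] G)) : Subgroup (Ω → B) :=
  H.comap SemidirectProduct.inl

theorem mem_basePart {H : Subgroup ((Ω → B) ⋊[mulAutArrow] G)} {f : Ω → B} :
    f ∈ basePart H ↔ SemidirectProduct.inl f ∈ H := Iff.rfl

theorem left_mem_basePart {H : Subgroup ((Ω → B) ⋊[mulAutArrow] G)}
    {a : (Ω → B) ⋊[mulAutArrow] G} (ha : a ∈ H) (h : a.right = 1) : a.left ∈ basePart H := by
  rw [mem_basePart]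
  convert ha
  ext1 <;> simp [h]

/-- Conjugation by an element of a wreath product, on the base group. -/
def baseConj (h : (Ω → B) ⋊[mulAutArrow] G) (f : Ω → B) : Ω → B :=
  fun p => h.left p * f (h.right⁻¹ • p) * (h.left p)⁻¹

theorem inl_baseConj (h : (Ω → B) ⋊[mulAutArrow] G) (f : Ω → B) :
    (SemidirectProduct.inl (baseConj h f) : (Ω → B) ⋊[mulAutArrow] G) =
      h * SemidirectProduct.inl f * h⁻¹ := by
  ext1
  · funext p
    simp [left_mul_apply, left_inv_apply, baseConj]
  · simp

theorem baseConj_mem {H : Subgroup ((Ω → B) ⋊[mulAutArrow] G)} {h : (Ω → B) ⋊[mulAutArrow] G}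
    (hh : h ∈ H) {f : Ω → B} (hf : f ∈ basePart H) : baseConj h f ∈ basePart H := by
  rw [mem_basePart, inl_baseConj]
  exact H.mul_mem (H.mul_mem hh hf) (H.inv_mem hh)

/-- Conjugation by an element of a wreath product, as an automorphism of the base group. -/
def baseConjEquiv (h : (Ω → B) ⋊[mulAutArrow] G) : (Ω → B) ≃* (Ω → B) where
  toFun := baseConj h
  invFun := baseConj h⁻¹
  left_inv f := by
    apply SemidirectProduct.inl_injective (φ := (mulAutArrow : G →* MulAut (Ω → B)))
    simp only [inl_baseConj]
    group
  right_inv f := by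
    apply SemidirectProduct.inl_injective (φ := (mulAutArrow : G →* MulAut (Ω → B)))
    simp only [inl_baseConj]
    group
  map_mul' f g := by
    funext p
    simp [baseConj, mul_assoc]

@[simp]
theorem baseConjEquiv_apply (h : (Ω → B) ⋊[mulAutArrow] G) (f : Ω → B) :
    baseConjEquiv h f = baseConj h f := rfl

/-- `K` is a proper normal subgroup of `M` containing the elements of `M` that vanish at `p`. -/
structure IsLocalAt (M K : Subgroup (Ω → B)) (p : Ω) : Prop where
  lt : K < M
  conj_mem : ∀ f ∈ M, ∀ g ∈ K, f * g * f⁻¹ ∈ K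
  mem : ∀ f ∈ M, f p = 1 → f ∈ K

/-- Two points are linked with respect to `M` if the coordinates of `M` at these points
have a common nontrivial quotient. -/
def Linked (M : Subgroup (Ω → B)) (p q : Ω) : Prop :=
  ∃ K, IsLocalAt M K p ∧ IsLocalAt M K q

theorem Linked.symm {M : Subgroup (Ω → B)} {p q : Ω} (h : Linked M p q) : Linked M q p :=
  let ⟨K, h1, h2⟩ := h
  ⟨K, h2, h1⟩

theorem IsLocalAt.conj {H : Subgroup ((Ω → B) ⋊[mulAutArrow] G)} {K : Subgroup (Ω → B)}
    {p : Ω} (hK : IsLocalAt (basePart H) K p) {h : (Ω → B) ⋊[mulAutArrow] G} (hh : h ∈ H) :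
    IsLocalAt (basePart H) (K.map (baseConjEquiv h).toMonoidHom) (h.right • p) := by
  have hinv : ∀ f, baseConj h (baseConj h⁻¹ f) = f :=
    (baseConjEquiv h).right_inv
  have hinv' : ∀ f, baseConj h⁻¹ (baseConj h f) = f :=
    (baseConjEquiv h).left_inv
  have hmem : ∀ f, f ∈ K.map (baseConjEquiv h).toMonoidHom ↔ baseConj h⁻¹ f ∈ K := by
    intro f
    constructor
    · rintro ⟨g, hg, rfl⟩
      simpa [hinv'] using hg
    · exact fun hf => ⟨_, hf, hinv f⟩
  refine ⟨lt_of_le_of_ne ?_ ?_, ?_, ?_⟩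
  · rintro _ ⟨g, hg, rfl⟩
    exact baseConj_mem hh (hK.lt.le hg)
  · intro heq
    apply hK.lt.not_ge
    intro f hf
    have h1 := baseConj_mem hh hf
    rw [← heq, hmem, hinv'] at h1
    exact h1
  · intro f hf g hg
    rw [hmem] at hg ⊢
    have h1 := hK.conj_mem _ (baseConj_mem (H.inv_mem hh) hf) _ hg
    simpa only [← baseConjEquiv_apply, ← map_mul, ← map_inv] using h1
  · intro f hf hfp
    rw [hmem]
    apply hK.mem _ (baseConj_mem (H.inv_mem hh) hf)
    simp [baseConj, hfp]

theorem Linked.smul {H : Subgroup ((Ω → B) ⋊[mulAutArrow] G)}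
    (hsurj : ∀ g : G, ∃ h ∈ H, h.right = g) {p q : Ω} (hpq : Linked (basePart H) p q) (g : G) :
    Linked (basePart H) (g • p) (g • q) := by
  obtain ⟨h, hh, rfl⟩ := hsurj g
  obtain ⟨K, h1, h2⟩ := hpq
  exact ⟨_, h1.conj hh, h2.conj hh⟩

/-- At a point fixed by `h`, conjugation by `h` agrees with conjugation by some `f` in the base
part. The two results differ by a function vanishing at `p`, and `K` absorbs both this function and
conjugation by `f`. -/
theorem IsLocalAt.map_eq {H : Subgroup ((Ω → B) ⋊[mulAutArrow] G)} {K : Subgroup (Ω → B)}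
    {p : Ω} (hK : IsLocalAt (basePart H) K p)
    (hfull : ∀ b : B, ∃ f ∈ basePart H, f p = b) {h : (Ω → B) ⋊[mulAutArrow] G} (hh : h ∈ H)
    (hp : h.right • p = p) : K.map (baseConjEquiv h).toMonoidHom ≤ K := by
  rintro _ ⟨k, hk, rfl⟩
  obtain ⟨f, hf, hfp⟩ := hfull (h.left p)
  have hp' : h.right⁻¹ • p = p := inv_smul_eq_iff.2 hp.symm
  have h1 := hK.conj_mem f hf k hk
  have h2 : baseConj h k * (f * k * f⁻¹)⁻¹ ∈ K := by
    apply hK.mem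
    · exact mul_mem (baseConj_mem hh (hK.lt.le hk)) (inv_mem (hK.lt.le h1))
    · simp [baseConj, hp', hfp]
  have h3 := mul_mem h2 h1
  rwa [inv_mul_cancel_right] at h3

theorem IsLocalAt.mono {M K K' : Subgroup (Ω → B)} {p : Ω} (h : IsLocalAt M K p)
    (hK' : K ≤ K') (q : Ω) (h' : IsLocalAt M K' q) : IsLocalAt M K' p :=
  ⟨h'.lt, h'.conj_mem, fun f hf hfp => hK' (h.mem f hf hfp)⟩

/-- The subgroup `K` linking `p` and `q` contains its own conjugate by a lift of `g`, and that
conjugate is local at `g • q`. So `K` itself links `q` and `g • q`. -/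
theorem Linked.smul_of_smul_eq {H : Subgroup ((Ω → B) ⋊[mulAutArrow] G)}
    (hsurj : ∀ g : G, ∃ h ∈ H, h.right = g)
    (hfull : ∀ (p : Ω) (b : B), ∃ f ∈ basePart H, f p = b) {p q : Ω}
    (hpq : Linked (basePart H) p q) {g : G} (hg : g • p = p) :
    Linked (basePart H) q (g • q) := by
  obtain ⟨h, hh, rfl⟩ := hsurj g
  obtain ⟨K, h1, h2⟩ := hpq
  exact ⟨K, h2, (h2.conj hh).mono (h1.map_eq (hfull p) hh hg) _ h2⟩

/-- An element fixing two linked points and acting trivially at the second one cannot act at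
the first one by a normal generator. -/
theorem not_linked (hB : Group.IsPerfect B) {H : Subgroup ((Ω → B) ⋊[mulAutArrow] G)}
    (hfull : ∀ (p : Ω) (b : B), ∃ f ∈ basePart H, f p = b) {p q : Ω}
    {h : (Ω → B) ⋊[mulAutArrow] G} (hh : h ∈ H) (hp : h.right • p = p) (hq : h.right • q = q)
    (hgen : Subgroup.normalClosure {h.left p} = ⊤) (hone : h.left q = 1) :
    ¬ Linked (basePart H) p q := by
  rintro ⟨K, h1, h2⟩
  have hp' : h.right⁻¹ • p = p := inv_smul_eq_iff.2 hp.symm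
  have hq' : h.right⁻¹ • q = q := inv_smul_eq_iff.2 hq.symm
  let R : Subgroup B := K.map (Pi.evalMonoidHom (fun _ : Ω => B) p)
  have hRn : R.Normal := by
    constructor
    rintro _ ⟨k, hk, rfl⟩ b
    obtain ⟨f, hf, rfl⟩ := hfull p b
    exact ⟨_, h1.conj_mem f hf k hk, rfl⟩
  have hKR : ∀ f ∈ basePart H, f p ∈ R → f ∈ K := by
    rintro f hf ⟨k, hk, hkf⟩
    have : f * k⁻¹ ∈ K := by
      apply h1.mem _ (mul_mem hf (inv_mem (h1.lt.le hk)))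
      simp at hkf
      simp [hkf]
    simpa using mul_mem this hk
  -- Commuting with `h` produces a function trivial at `q`, hence in `K`, whose value at `p` is the
  -- commutator. So `h.left p` is central modulo `R`; as it generates `B` normally, `B ⧸ R` is
  -- abelian, hence trivial.
  have hcent : ∀ b : B, ⁅h.left p, b⁆ ∈ R := by
    intro b
    obtain ⟨f, hf, rfl⟩ := hfull p b
    refine ⟨baseConj h f * f⁻¹, ?_, ?_⟩
    · apply h2.mem _ (mul_mem (baseConj_mem hh hf) (inv_mem hf))
      simp [baseConj, hq', hone]
    · simp [baseConj, hp', commutatorElement_def]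
  let Z : Subgroup B := (Subgroup.center (B ⧸ R)).comap (QuotientGroup.mk' R)
  have hmemR : ∀ a b : B, ⁅a, b⁆ ∈ R ↔ (b : B ⧸ R) * a = a * b := by
    intro a b
    rw [← QuotientGroup.eq_one_iff, commutatorElement_def]
    simp only [QuotientGroup.mk_mul, QuotientGroup.mk_inv]
    rw [mul_inv_eq_one, mul_inv_eq_iff_eq_mul, eq_comm]
  have hZ : Z = ⊤ := by
    rw [← top_le_iff, ← hgen]
    have : Z.Normal := inferInstance
    apply Subgroup.normalClosure_le_normal
    rw [Set.singleton_subset_iff]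
    change (QuotientGroup.mk' R (h.left p)) ∈ Subgroup.center (B ⧸ R)
    rw [Subgroup.mem_center_iff]
    intro b
    induction b using QuotientGroup.induction_on with
    | H b => exact (hmemR _ _).1 (hcent b)
  have hR : R = ⊤ := by
    apply eq_top_of_commutators_mem hB
    intro a b
    have ha : a ∈ Z := by rw [hZ]; trivial
    exact (hmemR a b).2 (Subgroup.mem_center_iff.1 ha _)
  exact h1.lt.not_ge fun f hf => hKR f hf (by rw [hR]; trivial)

/-- The product of the kernels at `q` and `p` is normal in `M` and contains both kernels, so it is
all of `M` in the absence of a link. In a factorization `f = a * c` the factor `a` has the required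
values. -/
theorem exists_mem_basePart_of_not_linked {M : Subgroup (Ω → B)}
    (hfull : ∀ (p : Ω) (b : B), ∃ f ∈ M, f p = b) {p q : Ω} (h : ¬ Linked M p q) (b : B) :
    ∃ f ∈ M, f p = b ∧ f q = 1 := by
  let N (p : Ω) : Subgroup (Ω → B) := M ⊓ (Pi.evalMonoidHom (fun _ : Ω => B) p).ker
  have hN : ∀ p f, f ∈ N p ↔ f ∈ M ∧ f p = 1 := fun p f => Iff.rfl
  have hconj : ∀ p, ∀ f ∈ M, ∀ g ∈ N p, f * g * f⁻¹ ∈ N p := by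
    intro p f hf g hg
    exact ⟨M.mul_mem (M.mul_mem hf hg.1) (M.inv_mem hf), by
      have := ((hN _ _).1 hg).2
      simp [this]⟩
  let K : Subgroup (Ω → B) :=
    { carrier := {f | ∃ a ∈ N q, ∃ c ∈ N p, f = a * c}
      one_mem' := ⟨1, one_mem _, 1, one_mem _, by simp⟩
      mul_mem' := by
        rintro _ _ ⟨a, ha, c, hc, rfl⟩ ⟨a', ha', c', hc', rfl⟩
        exact ⟨a * (c * a' * c⁻¹), mul_mem ha (hconj q c hc.1 a' ha'), c * c', mul_mem hc hc',
          by group⟩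
      inv_mem' := by
        rintro _ ⟨a, ha, c, hc, rfl⟩
        refine ⟨c⁻¹ * a⁻¹ * c, ?_, c⁻¹, inv_mem hc, by group⟩
        simpa using hconj q c⁻¹ (M.inv_mem ((hN _ _).1 hc).1) a⁻¹ ((N q).inv_mem ha) }
  have hKM : K = M := by
    by_contra hne
    have hle : K ≤ M := by
      rintro _ ⟨a, ha, c, hc, rfl⟩
      exact mul_mem ha.1 hc.1
    have hc : ∀ f ∈ M, ∀ g ∈ K, f * g * f⁻¹ ∈ K := by
      rintro f hf _ ⟨a, ha, c, hc, rfl⟩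
      exact ⟨_, hconj q f hf a ha, _, hconj p f hf c hc, by group⟩
    exact h ⟨K, ⟨lt_of_le_of_ne hle hne, hc, fun f hf hfp => ⟨1, one_mem _, f, ⟨hf, hfp⟩, by simp⟩⟩,
      ⟨lt_of_le_of_ne hle hne, hc, fun f hf hfp => ⟨f, ⟨hf, hfp⟩, 1, one_mem _, by simp⟩⟩⟩
  obtain ⟨f, hf, rfl⟩ := hfull p b
  rw [← hKM] at hf
  obtain ⟨a, ha, c, hc, rfl⟩ := hf
  refine ⟨a, ha.1, ?_, ((hN _ _).1 ha).2⟩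
  simp [((hN _ _).1 hc).2]

/-- If `f` vanishes on `T` and `g` vanishes at `q`, their commutator vanishes on both. As `B` is
perfect, commutators still produce every value at `p`, so zeros can be added one point at a time. -/
theorem eq_top_of_not_linked [Finite Ω] (hB : Group.IsPerfect B) {M : Subgroup (Ω → B)}
    (hfull : ∀ (p : Ω) (b : B), ∃ f ∈ M, f p = b)
    (h : ∀ p q, Linked M p q → p = q) : M = ⊤ := by
  classical
  have := Fintype.ofFinite Ω
  have key : ∀ (p : Ω) (T : Finset Ω), p ∉ T → ∀ b : B, ∃ f ∈ M, f p = b ∧ ∀ q ∈ T, f q = 1 := by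
    intro p T
    induction T using Finset.induction_on with
    | empty =>
      intro _ b
      obtain ⟨f, hf, hfp⟩ := hfull p b
      exact ⟨f, hf, hfp, by simp⟩
    | insert q T _ ih =>
      intro hp
      have hpq : p ≠ q := fun e => hp (e ▸ Finset.mem_insert_self _ _)
      have ih := ih fun e => hp (Finset.mem_insert_of_mem e)
      let R : Subgroup B :=
        { carrier := {b | ∃ f ∈ M, f p = b ∧ ∀ x ∈ insert q T, f x = 1}
          one_mem' := ⟨1, one_mem _, rfl, fun _ _ => rfl⟩
          mul_mem' := by
            rintro _ _ ⟨f, hf, rfl, hf'⟩ ⟨g, hg, rfl, hg'⟩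
            exact ⟨f * g, mul_mem hf hg, rfl, fun x hx => by simp [hf' x hx, hg' x hx]⟩
          inv_mem' := by
            rintro _ ⟨f, hf, rfl, hf'⟩
            exact ⟨f⁻¹, inv_mem hf, rfl, fun x hx => by simp [hf' x hx]⟩ }
      have hR : R = ⊤ := by
        have hRn : R.Normal := by
          constructor
          rintro _ ⟨f, hf, rfl, hf'⟩ b
          obtain ⟨g, hg, rfl⟩ := hfull p b
          exact ⟨g * f * g⁻¹, mul_mem (mul_mem hg hf) (inv_mem hg), rfl,
            fun x hx => by simp [hf' x hx]⟩
        apply eq_top_of_commutators_mem hB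
        intro a b
        obtain ⟨f, hf, rfl, hfT⟩ := ih a
        obtain ⟨g, hg, rfl, hgq⟩ :=
          exists_mem_basePart_of_not_linked hfull (fun e => hpq (h p q e)) b
        refine ⟨f * g * f⁻¹ * g⁻¹,
          mul_mem (mul_mem (mul_mem hf hg) (inv_mem hf)) (inv_mem hg), rfl, fun x hx => ?_⟩
        rcases Finset.mem_insert.1 hx with rfl | hx
        · simp [hgq]
        · simp [hfT x hx]
      intro b
      have hb : b ∈ R := by rw [hR]; trivial
      exact hb
  rw [← top_le_iff]
  intro f _
  apply Subgroup.pi_mem_of_mulSingle_mem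
  intro p
  obtain ⟨g, hg, hgp, hgq⟩ := key p (Finset.univ.erase p) (by simp) (f p)
  convert hg
  funext q
  by_cases hq : q = p
  · subst hq; simp [hgp]
  · rw [Pi.mulSingle_eq_of_ne hq, hgq q (by simp [hq])]

end WreathSubgroups

/-! ### Lifting generators through a wreath product. -/

section Generation

variable {Ω B G : Type*} [Group B] [Group G] [MulAction G Ω] {ι τ : Type*}

/-- The properties of the relation of being linked with respect to the base part of a subgroup
that projects onto `G`. -/
structure LinkRel (G : Type*) {Ω : Type*} [Group G] [MulAction G Ω] (r : Ω → Ω → Prop) :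
    Prop where
  symm : ∀ p q, r p q → r q p
  smul : ∀ p q, r p q → ∀ g : G, r (g • p) (g • q)
  stab : ∀ p q, r p q → ∀ g : G, g • p = p → r q (g • q)

theorem closure_lift_eq_top [Finite Ω] [MulAction.IsPretransitive G Ω] (hB : Group.IsPerfect B)
    (x : ι → G) (hx : Subgroup.closure (Set.range x) = ⊤) (F : ι → Ω → B) (idx : τ → ι)
    (b : τ → B) (hb : Subgroup.closure (Set.range b) = ⊤) (w : Ω) (δ : G)
    (hfix : ∀ t, x (idx t) • w = w) (hcomm : ∀ t, Commute δ (x (idx t)))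
    (hFw : ∀ t, F (idx t) w = b t) (hFδ : ∀ t, F (idx t) (δ • w) = 1)
    (hrel : ∀ r : Ω → Ω → Prop, LinkRel G r →
      (∀ p q, r p q → ∀ h ∈ Subgroup.closure
          (Set.range fun i => (⟨F i, x i⟩ : (Ω → B) ⋊[mulAutArrow] G)),
        h.right • p = p → h.right • q = q → h.left q = 1 →
          Subgroup.normalClosure {h.left p} ≠ ⊤) → ∀ p q, r p q → p = q) :
    Subgroup.closure (Set.range fun i => (⟨F i, x i⟩ : (Ω → B) ⋊[mulAutArrow] G)) = ⊤ := by
  set H := Subgroup.closure (Set.range fun i => (⟨F i, x i⟩ : (Ω → B) ⋊[mulAutArrow] G)) with hH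
  have hmem : ∀ i, (⟨F i, x i⟩ : (Ω → B) ⋊[mulAutArrow] G) ∈ H :=
    fun i => Subgroup.subset_closure ⟨i, rfl⟩
  have hsurj : ∀ g : G, ∃ h ∈ H, h.right = g := by
    have h1 : H.map (SemidirectProduct.rightHom : (Ω → B) ⋊[mulAutArrow] G →* G) = ⊤ := by
      rw [hH, MonoidHom.map_closure, ← Set.range_comp, ← hx]
      rfl
    intro g
    have hg : g ∈ H.map (SemidirectProduct.rightHom : (Ω → B) ⋊[mulAutArrow] G →* G) := by
      rw [h1]; trivial
    exact hg
  have hfullδ : ∀ c : B, ∃ f ∈ basePart H, f (δ • w) = c := by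
    obtain ⟨h, hh, hδ⟩ := hsurj δ
    let R : Subgroup B := (basePart H).map (Pi.evalMonoidHom (fun _ : Ω => B) (δ • w))
    -- The commutator of `h`, a lift of `δ`, with the generator `a` lies over `1`. Its coordinate at
    -- `δ • w` is `b t` conjugated by `h.left (δ • w)`.
    have hR : R.comap (MulAut.conj (h.left (δ • w))).toMonoidHom = ⊤ := by
      rw [← top_le_iff, ← hb, Subgroup.closure_le]
      rintro _ ⟨t, rfl⟩
      let a : (Ω → B) ⋊[mulAutArrow] G := ⟨F (idx t), x (idx t)⟩
      have ha : a ∈ H := hmem _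
      have hr : (h * a * h⁻¹ * a⁻¹).right = 1 := by
        simp [a, hδ, (hcomm t).eq]
      refine ⟨(h * a * h⁻¹ * a⁻¹).left, left_mem_basePart
        (mul_mem (mul_mem (mul_mem hh ha) (inv_mem hh)) (inv_mem ha)) hr, ?_⟩
      have hfixδ : x (idx t) • δ • w = δ • w := by
        rw [← mul_smul, ← (hcomm t).eq, mul_smul, hfix]
      have h1 : h * a * h⁻¹ * a⁻¹ * (a * h) = h * a := by group
      have h2 := congrArg (fun y => y.left (δ • w)) h1
      simp only [left_mul_apply _ (a * h), hr, left_mul_apply h a, left_mul_apply a h] at h2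
      have h3 : (x (idx t))⁻¹ • δ • w = δ • w := inv_smul_eq_iff.2 hfixδ.symm
      simp only [inv_one, one_smul, a, hFδ, one_mul, hδ, inv_smul_smul, hFw, h3] at h2
      simpa [eq_mul_inv_iff_mul_eq] using h2
    intro c
    have hc : (h.left (δ • w))⁻¹ * c * h.left (δ • w) ∈
        R.comap (MulAut.conj (h.left (δ • w))).toMonoidHom := by rw [hR]; trivial
    obtain ⟨f, hf, hfc⟩ := hc
    exact ⟨f, hf, by simpa [mul_assoc] using hfc⟩
  have hfull : ∀ (p : Ω) (c : B), ∃ f ∈ basePart H, f p = c := by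
    intro p c
    obtain ⟨g, rfl⟩ := MulAction.exists_smul_eq G (δ • w) p
    obtain ⟨h, hh, rfl⟩ := hsurj g
    obtain ⟨f, hf, hfc⟩ := hfullδ ((h.left (h.right • δ • w))⁻¹ * c * h.left (h.right • δ • w))
    exact ⟨_, baseConj_mem hh hf, by simp [baseConj, hfc, mul_assoc]⟩
  have htop : basePart H = ⊤ := by
    apply eq_top_of_not_linked hB hfull
    apply hrel
    · exact ⟨fun p q h => h.symm, fun p q h g => h.smul hsurj g,
        fun p q h g hg => h.smul_of_smul_eq hsurj hfull hg⟩
    · intro p q hpq h hh hp hq hone hgen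
      exact not_linked hB hfull hh hp hq hgen hone hpq
  rw [← top_le_iff]
  intro a _
  obtain ⟨h, hh, hr⟩ := hsurj a.right
  have h1 : a = SemidirectProduct.inl (a * h⁻¹).left * h := by
    have h2 : a * h⁻¹ = SemidirectProduct.inl (a * h⁻¹).left := by
      ext1 <;> simp [hr]
    rw [← h2]; group
  rw [h1]
  refine mul_mem ?_ hh
  rw [← mem_basePart, htop]
  trivial

theorem pow_left_apply_eq_one (f : Ω → B) (v : G) (n : ℕ) (p : Ω)
    (h : ∀ i < n, f ((v ^ i)⁻¹ • p) = 1) :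
    ((⟨f, v⟩ : (Ω → B) ⋊[mulAutArrow] G) ^ n).left p = 1 := by
  induction n generalizing p with
  | zero => rfl
  | succ n ih =>
    rw [pow_succ', left_mul_apply, ih]
    · have := h 0 (by omega)
      simpa using this
    · intro i hi
      have := h (i + 1) (by omega)
      rwa [pow_succ', mul_inv_rev, mul_smul] at this

theorem pow_right (a : (Ω → B) ⋊[mulAutArrow] G) (n : ℕ) : (a ^ n).right = a.right ^ n :=
  map_pow (SemidirectProduct.rightHom : (Ω → B) ⋊[mulAutArrow] G →* G) a n

/-- A tuple with a fixed point `w`, commuting with an element that moves `w`, and such that the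
points different from `w` fixed by the tuple suffice to detect that a link relation is trivial. -/
def Directed {G Ω : Type*} [Group G] [MulAction G Ω] (v : τ → G) : Prop :=
  ∃ (w : Ω) (δ : G), (∀ t, v t • w = w) ∧ (∀ t, Commute δ (v t)) ∧ δ • w ≠ w ∧
    ∀ r : Ω → Ω → Prop, LinkRel G r → (∀ y, r w y → (∀ t, v t • y = y) → y = w) →
      ∀ p q, r p q → p = q

/-- A tuple with a fixed point `w`, commuting with an element that moves `w`, and such that the
points outside the cycle of a suitable point `P` under one element of the tuple suffice to detect
that a link relation is trivial. -/
def Separating {G Ω : Type*} [Group G] [MulAction G Ω] (v : τ → G) (t₀ : τ) : Prop :=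
  ∃ (w P : Ω) (δ : G) (l : ℕ), (∀ t, v t • w = w) ∧ (∀ t, Commute δ (v t)) ∧ δ • w ≠ w ∧
    δ • w ≠ P ∧ P ≠ w ∧ 0 < l ∧ (∀ p : Ω, v t₀ ^ l • p = p) ∧
    (∀ i, 0 < i → i < l → v t₀ ^ i • P ≠ P) ∧
    ∀ r : Ω → Ω → Prop, LinkRel G r →
      (∀ y, r P y → y ≠ w → ∃ i : ℕ, v t₀ ^ i • P = y) → ∀ p q, r p q → p = q

-- The lifts carry `b t` at `w`, and the one at `t₀` also carries a normal generator `g` at `P`. Its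
-- `l`-th power fixes all points and has coordinate `g` at `P`, since the cycle of `P` has full
-- length `l` and meets `P` once. Its coordinate is `1` at points other than `w` outside this cycle,
-- so `P` is linked to none of them.
open Classical in
theorem exists_lift_of_separating [Finite Ω] [MulAction.IsPretransitive G Ω] [Finite B]
    (hB : Group.IsPerfect B)
    (x : ι → G) (hx : Subgroup.closure (Set.range x) = ⊤) (idx : τ → ι)
    (hidx : Function.Injective idx)
    (b : τ → B) (hb : Subgroup.closure (Set.range b) = ⊤) (t₀ : τ)
    (hsep : Separating (Ω := Ω) (fun t => x (idx t)) t₀) :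
    ∃ F : ι → Ω → B, (∀ i, i ∉ Set.range idx → F i = 1) ∧
    Subgroup.closure (Set.range fun i => (⟨F i, x i⟩ : (Ω → B) ⋊[mulAutArrow] G)) = ⊤ := by
  obtain ⟨w, P, δ, l, hfix, hcomm, hδ, hδP, hPw, hl, hper, hmin, hrel⟩ := hsep
  obtain ⟨g, hg⟩ := exists_normalClosure_singleton_eq_top hB
  let f : τ → Ω → B := fun t => Pi.mulSingle w (b t) * if t = t₀ then Pi.mulSingle P g else 1
  let F : ι → Ω → B := Function.extend idx f 1
  have hF : ∀ t, F (idx t) = f t := fun t => hidx.extend_apply _ _ _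
  have hone : ∀ t y, y ≠ w → y ≠ P → f t y = 1 := by
    intro t y h1 h2
    by_cases ht : t = t₀ <;> simp [f, ht, h1, h2]
  refine ⟨F, fun i hi => Function.extend_apply' _ _ _ hi, ?_⟩
  refine closure_lift_eq_top hB x hx F idx b hb w δ hfix hcomm ?_ ?_ ?_
  · intro t
    rw [hF]
    by_cases ht : t = t₀ <;> simp [f, ht, hPw.symm]
  · intro t
    rw [hF]
    exact hone t _ hδ hδP
  · intro r hr hlink
    apply hrel r hr
    intro y hPy hyw
    by_contra! hcyc
    have hright : ∀ p : Ω, ((⟨F (idx t₀), x (idx t₀)⟩ : (Ω → B) ⋊[mulAutArrow] G) ^ l).right • p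
        = p := by
      intro p
      rw [pow_right]
      exact hper p
    have hfixpow : ∀ i : ℕ, (x (idx t₀) ^ i) • w = w := by
      intro i
      induction i with
      | zero => simp
      | succ i ih => rw [pow_succ', mul_smul, ih, hfix]
    have hnw : ∀ (i : ℕ) (p : Ω), p ≠ w → (x (idx t₀) ^ i)⁻¹ • p ≠ w := by
      intro i p hp h
      rw [inv_smul_eq_iff, hfixpow] at h
      exact hp h
    refine hlink P y hPy ((⟨F (idx t₀), x (idx t₀)⟩ : (Ω → B) ⋊[mulAutArrow] G) ^ l)
      (pow_mem (Subgroup.subset_closure (Set.mem_range_self (idx t₀))) l)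
      (hright P) (hright y) ?_ ?_
    · apply pow_left_apply_eq_one
      intro i _
      rw [hF]
      refine hone _ _ (hnw i y hyw) fun h => hcyc i ?_
      rw [inv_smul_eq_iff] at h
      exact h.symm
    · obtain ⟨n, rfl⟩ : ∃ n, l = n + 1 := ⟨l - 1, by omega⟩
      rw [pow_succ', left_mul_apply, pow_left_apply_eq_one, mul_one]
      · simpa [hF, f, hPw] using hg
      · intro i hi
        rw [hF, ← mul_smul, ← mul_inv_rev, ← pow_succ']
        refine hone _ _ (hnw _ _ hPw) fun h => ?_
        rw [inv_smul_eq_iff] at h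
        exact hmin (i + 1) (by omega) (by omega) h.symm

-- The lifts carry `b t` at `w` only, so words in them realize any element of `B` at `w` and `1` at
-- any other common fixed point, which excludes a link. The point `q` is `δ • w`.
open Classical in
theorem exists_lift_of_directed [Finite Ω] [MulAction.IsPretransitive G Ω] [Finite B]
    (hB : Group.IsPerfect B)
    (x : ι → G) (hx : Subgroup.closure (Set.range x) = ⊤) (idx : τ → ι)
    (hidx : Function.Injective idx)
    (b : τ → B) (hb : Subgroup.closure (Set.range b) = ⊤)
    (hdir : Directed (Ω := Ω) (fun t => x (idx t))) :
    ∃ (F : ι → Ω → B) (q : Ω), (∀ i, i ∉ Set.range idx → F i = 1) ∧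
    (∀ t, F (idx t) q = 1 ∧ x (idx t) • q = q) ∧
    Subgroup.closure (Set.range fun i => (⟨F i, x i⟩ : (Ω → B) ⋊[mulAutArrow] G)) = ⊤ := by
  obtain ⟨w, δ, hfix, hcomm, hδ, hrel⟩ := hdir
  obtain ⟨g, hg⟩ := exists_normalClosure_singleton_eq_top hB
  let F : ι → Ω → B := Function.extend idx (fun t => Pi.mulSingle w (b t)) 1
  have hF : ∀ t, F (idx t) = Pi.mulSingle w (b t) := fun t => hidx.extend_apply _ _ _
  have hFδ : ∀ t, F (idx t) (δ • w) = 1 := fun t => by simp [hF, hδ]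
  have hFw : ∀ t, F (idx t) w = b t := fun t => by simp [hF]
  refine ⟨F, δ • w, fun i hi => Function.extend_apply' _ _ _ hi, fun t => ⟨hFδ t, ?_⟩, ?_⟩
  · rw [← mul_smul, ← (hcomm t).eq, mul_smul, hfix]
  refine closure_lift_eq_top hB x hx F idx b hb w δ hfix hcomm hFw hFδ ?_
  intro r hr hlink
  apply hrel r hr
  intro y hwy hy
  by_contra hne
  let H := Subgroup.closure (Set.range fun i => (⟨F i, x i⟩ : (Ω → B) ⋊[mulAutArrow] G))
  have key : ∀ c : B, c ∈ Subgroup.closure (Set.range b) →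
      ∃ h ∈ H, h.right • w = w ∧ h.right • y = y ∧ h.left w = c ∧ h.left y = 1 := by
    intro c hc
    induction hc using Subgroup.closure_induction with
    | mem c hc =>
      obtain ⟨t, rfl⟩ := hc
      exact ⟨_, Subgroup.subset_closure ⟨idx t, rfl⟩, hfix t, hy t, hFw t, by simp [hF, hne]⟩
    | one => exact ⟨1, one_mem _, by simp, by simp, rfl, rfl⟩
    | mul a c _ _ iha ihc =>
      obtain ⟨h, hh, h1, h2, rfl, h3⟩ := iha
      obtain ⟨k, hk, k1, k2, rfl, k3⟩ := ihc
      have h1' : h.right⁻¹ • w = w := inv_smul_eq_iff.2 h1.symm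
      have h2' : h.right⁻¹ • y = y := inv_smul_eq_iff.2 h2.symm
      refine ⟨h * k, mul_mem hh hk, ?_, ?_, ?_, ?_⟩
      · simp [mul_smul, h1, k1]
      · simp [mul_smul, h2, k2]
      · simp [left_mul_apply, h1']
      · simp [left_mul_apply, h2', h3, k3]
    | inv a _ iha =>
      obtain ⟨h, hh, h1, h2, rfl, h3⟩ := iha
      refine ⟨h⁻¹, inv_mem hh, inv_smul_eq_iff.2 h1.symm, inv_smul_eq_iff.2 h2.symm, ?_, ?_⟩
      · rw [left_inv_apply, h1]
      · rw [left_inv_apply, h2, h3, inv_one]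
  obtain ⟨h, hh, h1, h2, h3, h4⟩ := key g (by rw [hb]; trivial)
  exact hlink w y hwy h hh h1 h2 h4 (by rw [h3]; exact hg)

end Generation

/-! ### Stabilizers in transitive actions. -/

theorem exists_smul_eq_and_smul_ne {G X : Type*} [Group G] [Finite G] [MulAction G X]
    [MulAction.IsPretransitive G X] {x y : X}
    (h : MulAction.stabilizer G x ≠ MulAction.stabilizer G y) :
    ∃ s : G, s • x = x ∧ s • y ≠ y := by
  by_contra! hs
  apply h
  obtain ⟨g, rfl⟩ := MulAction.exists_smul_eq G x y
  -- Point stabilizers are conjugate, so they have the same finite order and inclusion forces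
  -- equality.
  refine Subgroup.eq_of_le_of_card_ge (fun s hs' => hs s hs') ?_
  exact (Nat.card_congr (MulAction.stabilizerEquivStabilizer
    (rfl : g • x = g • x)).toEquiv).ge

theorem stabilizer_smul_eq_iff {G X : Type*} [Group G] [MulAction G X] (g : G) (x y : X) :
    MulAction.stabilizer G (g • x) = MulAction.stabilizer G (g • y) ↔
      MulAction.stabilizer G x = MulAction.stabilizer G y := by
  rw [MulAction.stabilizer_smul_eq_stabilizer_map_conj,
    MulAction.stabilizer_smul_eq_stabilizer_map_conj]
  exact (Subgroup.map_injective (MulEquiv.injective (MulAut.conj g))).eq_iff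

/-! ### The two actions of a wreath product. -/

variable {τ : Type*} {A P : PermGroup}

/-- An element of the wreath product, in the permutational action. -/
def toPermutational (g : Wreath A P) : (permutational A P).Elem := g

/-- An element of the wreath product, in the product action. -/
def toExponentiation (g : Wreath A P) : (exponentiation A P).Elem := g

/-- A pair of points, as a point of the permutational action. -/
def pairPoint (x : A.Point) (p : P.Point) : (permutational A P).Point := (x, p)

/-- A function on points, as a point of the product action. -/
def funPoint (f : P.Point → A.Point) : (exponentiation A P).Point := f

theorem exists_eq_pairPoint (y : (permutational A P).Point) : ∃ x p, y = pairPoint x p :=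
  ⟨y.1, y.2, rfl⟩

theorem pairPoint_inj {x x' : A.Point} {p p' : P.Point} :
    (pairPoint x p : (permutational A P).Point) = pairPoint x' p' ↔ x = x' ∧ p = p' :=
  Prod.mk_inj

theorem forall_point_exponentiation {C : (exponentiation A P).Point → Prop}
    (h : ∀ f, C (funPoint f)) (y : (exponentiation A P).Point) : C y := h y

theorem funPoint_inj {f g : P.Point → A.Point} :
    (funPoint f : (exponentiation A P).Point) = funPoint g ↔ f = g := Iff.rfl

theorem toPermutational_smul (g : Wreath A P) (x : A.Point) (p : P.Point) :
    toPermutational g • pairPoint x p = pairPoint (g.left (g.right • p) • x) (g.right • p) := rfl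

theorem toExponentiation_smul (g : Wreath A P) (f : P.Point → A.Point) :
    toExponentiation g • funPoint f = funPoint fun q => g.left q • f (g.right⁻¹ • q) := rfl

theorem toPermutational_inl_smul (a : P.Point → A.Elem) (x : A.Point) (p : P.Point) :
    toPermutational (SemidirectProduct.inl a) • pairPoint x p = pairPoint (a p • x) p := by
  simp [toPermutational_smul]

theorem toPermutational_inr_smul (g : P.Elem) (x : A.Point) (p : P.Point) :
    toPermutational (SemidirectProduct.inr g : Wreath A P) • pairPoint x p =
      pairPoint x (g • p) := by
  simp [toPermutational_smul]

theorem toPermutational_inr_pow (g : P.Elem) (i : ℕ) :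
    (toPermutational (SemidirectProduct.inr g : Wreath A P)) ^ i =
      toPermutational (SemidirectProduct.inr (g ^ i)) :=
  (map_pow (SemidirectProduct.inr : P.Elem →* Wreath A P) g i).symm

theorem toExponentiation_inl_smul (a : P.Point → A.Elem) (f : P.Point → A.Point) :
    toExponentiation (SemidirectProduct.inl a) • funPoint f = funPoint fun q => a q • f q := by
  simp [toExponentiation_smul]

theorem toExponentiation_inr_smul (g : P.Elem) (f : P.Point → A.Point) :
    toExponentiation (SemidirectProduct.inr g : Wreath A P) • funPoint f =
      funPoint fun q => f (g⁻¹ • q) := by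
  simp [toExponentiation_smul]

theorem toExponentiation_inr_pow (g : P.Elem) (i : ℕ) :
    (toExponentiation (SemidirectProduct.inr g : Wreath A P)) ^ i =
      toExponentiation (SemidirectProduct.inr (g ^ i)) :=
  (map_pow (SemidirectProduct.inr : P.Elem →* Wreath A P) g i).symm

theorem commute_inl_const_inr (a : A.Elem) (g : P.Elem) :
    Commute (SemidirectProduct.inl (fun _ => a) : Wreath A P) (SemidirectProduct.inr g) := by
  apply SemidirectProduct.ext
  · funext p
    simp [left_mul_apply]
  · simp

theorem isPretransitive_permutational [MulAction.IsPretransitive A.Elem A.Point]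
    [MulAction.IsPretransitive P.Elem P.Point] :
    MulAction.IsPretransitive (permutational A P).Elem (permutational A P).Point := by
  constructor
  rintro ⟨x, p⟩ ⟨y, q⟩
  obtain ⟨g, rfl⟩ := MulAction.exists_smul_eq P.Elem p q
  obtain ⟨a, rfl⟩ := MulAction.exists_smul_eq A.Elem x y
  exact ⟨toPermutational ⟨fun _ => a, g⟩, toPermutational_smul _ x p⟩

theorem exists_inl_smul_funPoint_eq [MulAction.IsPretransitive A.Elem A.Point]
    (f g : P.Point → A.Point) : ∃ a : P.Point → A.Elem, ∀ q, a q • f q = g q := by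
  choose a ha using fun q : P.Point => MulAction.exists_smul_eq A.Elem (f q) (g q)
  exact ⟨a, ha⟩

theorem isPretransitive_exponentiation [MulAction.IsPretransitive A.Elem A.Point] :
    MulAction.IsPretransitive (exponentiation A P).Elem (exponentiation A P).Point := by
  constructor
  intro f g
  obtain ⟨a, ha⟩ := exists_inl_smul_funPoint_eq f g
  exact ⟨toExponentiation (SemidirectProduct.inl a),
    (toExponentiation_inl_smul a f).trans (funext ha)⟩

/-! ### Directed and separating tuples in the two actions. -/

theorem directed_one [Nontrivial P.Point] [MulAction.IsPretransitive P.Elem P.Point] :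
    Directed (Ω := P.Point) (fun _ : τ => (1 : P.Elem)) := by
  obtain ⟨w, w', hw⟩ := exists_pair_ne P.Point
  obtain ⟨δ, rfl⟩ := MulAction.exists_smul_eq P.Elem w w'
  refine ⟨w, δ, by simp, by simp, hw.symm, fun r hr h p q hpq => ?_⟩
  obtain ⟨g, rfl⟩ := MulAction.exists_smul_eq P.Elem w p
  have h1 := hr.smul _ _ hpq g⁻¹
  rw [inv_smul_smul] at h1
  have h2 := h _ h1 (by simp)
  rw [inv_smul_eq_iff] at h2
  exact h2.symm

-- The tuple fixes the whole fibre over `q`, so the directed condition is tested inside fibres. A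
-- link between different fibres would, by moving one endpoint with an element supported on its
-- fibre, give a link inside a fibre.
open Classical in
theorem directed_permutational [Nontrivial A.Point] [MulAction.IsPretransitive A.Elem A.Point]
    [MulAction.IsPretransitive P.Elem P.Point] (v : τ → Wreath A P) (q : P.Point)
    (h1 : ∀ t, (v t).left q = 1) (h2 : ∀ t, (v t).right • q = q) :
    Directed (Ω := (permutational A P).Point) (fun t => toPermutational (v t)) := by
  obtain ⟨x, x', hx⟩ := exists_pair_ne A.Point
  obtain ⟨a, rfl⟩ := MulAction.exists_smul_eq A.Elem x x'
  have hfix : ∀ t (y : A.Point), toPermutational (v t) • pairPoint y q = pairPoint y q := by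
    intro t y
    rw [toPermutational_smul, h2, h1, one_smul]
  refine ⟨pairPoint x q, toPermutational (SemidirectProduct.inl (Pi.mulSingle q a)),
    fun t => hfix t x, ?_, ?_, ?_⟩
  · intro t
    change (SemidirectProduct.inl (Pi.mulSingle q a) : Wreath A P) * v t =
      v t * SemidirectProduct.inl (Pi.mulSingle q a)
    ext1
    · funext p
      rw [left_mul_apply, left_mul_apply]
      have h3 : (v t).right⁻¹ • q = q := inv_smul_eq_iff.2 (h2 t).symm
      by_cases hp : p = q
      · subst hp
        simp [h1, h3]
      · have hp' : (v t).right⁻¹ • p ≠ q := by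
          intro h
          rw [inv_smul_eq_iff, h2] at h
          exact hp h
        simp [hp, hp']
    · simp
  · rw [toPermutational_inl_smul, Pi.mulSingle_eq_same, ne_eq, pairPoint_inj]
    exact fun h => hx h.1.symm
  · intro r hr hrel
    have key : ∀ (p : P.Point) (y z : A.Point), r (pairPoint y p) (pairPoint z p) → y = z := by
      intro p y z h
      obtain ⟨g, hg⟩ := MulAction.exists_smul_eq P.Elem p q
      obtain ⟨c, hc⟩ := MulAction.exists_smul_eq A.Elem y x
      have h4 := hr.smul _ _ h (toPermutational ⟨fun _ => c, g⟩)
      rw [toPermutational_smul, toPermutational_smul] at h4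
      simp only [hg, hc] at h4
      have h5 := hrel _ h4 (fun t => hfix t _)
      rw [pairPoint_inj, ← hc] at h5
      exact (MulAction.injective c h5.1).symm
    intro y z h
    obtain ⟨y, p, rfl⟩ := exists_eq_pairPoint y
    obtain ⟨z, p', rfl⟩ := exists_eq_pairPoint z
    by_cases hp : p = p'
    · subst hp
      rw [key p y z h]
    · exfalso
      obtain ⟨z', hz'⟩ := exists_ne z
      obtain ⟨c, rfl⟩ := MulAction.exists_smul_eq A.Elem z z'
      have h3 := hr.stab _ _ h (toPermutational (SemidirectProduct.inl (Pi.mulSingle p' c)))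
        (by rw [toPermutational_inl_smul]; simp [hp])
      rw [toPermutational_inl_smul, Pi.mulSingle_eq_same] at h3
      exact hz' (key p' _ _ h3).symm

theorem separating_permutational [Nonempty A.Point] [MulAction.IsPretransitive A.Elem A.Point]
    [MulAction.IsPretransitive P.Elem P.Point]
    (v : τ → P.Elem) (t₀ : τ) (h : Separating (Ω := P.Point) v t₀) :
    Separating (Ω := (permutational A P).Point)
      (fun t => toPermutational (SemidirectProduct.inr (v t) : Wreath A P)) t₀ := by
  obtain ⟨w, P', δ, l, hfix, hcomm, hδ, hδP, hPw, hl, hper, hmin, hrel⟩ := h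
  obtain ⟨x₀⟩ := ‹Nonempty A.Point›
  refine ⟨pairPoint x₀ w, pairPoint x₀ P', toPermutational (SemidirectProduct.inr δ), l, ?_, ?_,
    ?_, ?_, ?_, hl, ?_, ?_, ?_⟩
  · intro t
    rw [toPermutational_inr_smul, hfix]
  · intro t
    exact (hcomm t).map (SemidirectProduct.inr : P.Elem →* Wreath A P)
  · rw [toPermutational_inr_smul, ne_eq, pairPoint_inj]
    exact fun h => hδ h.2
  · rw [toPermutational_inr_smul, ne_eq, pairPoint_inj]
    exact fun h => hδP h.2
  · rw [ne_eq, pairPoint_inj]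
    exact fun h => hPw h.2
  · intro y
    obtain ⟨x, p, rfl⟩ := exists_eq_pairPoint y
    rw [toPermutational_inr_pow, toPermutational_inr_smul, hper]
  · intro i h1 h2 h
    rw [toPermutational_inr_pow, toPermutational_inr_smul, pairPoint_inj] at h
    exact hmin i h1 h2 h.2
  · intro r hr hrel'
    have hmove : ∀ x p z q, r (pairPoint x p) (pairPoint z q) → ∀ (a : A.Elem) (g : P.Elem),
        r (pairPoint (a • x) (g • p)) (pairPoint (a • z) (g • q)) := by
      intro x p z q h a g
      exact hr.smul _ _ h (toPermutational ⟨fun _ => a, g⟩)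
    have hbase : ∀ x z q, r (pairPoint x P') (pairPoint z q) → q ≠ w →
        z = x ∧ ∃ i : ℕ, v t₀ ^ i • P' = q := by
      intro x z q h hq
      obtain ⟨a, ha⟩ := MulAction.exists_smul_eq A.Elem x x₀
      have h1 := hmove _ _ _ _ h a 1
      rw [ha, one_smul, one_smul] at h1
      obtain ⟨i, hi⟩ := hrel' _ h1 (by
        rw [ne_eq, pairPoint_inj]
        exact fun h => hq h.2)
      rw [toPermutational_inr_pow, toPermutational_inr_smul, pairPoint_inj, ← ha] at hi
      exact ⟨(MulAction.injective a hi.1).symm, i, hi.2⟩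
    -- The projection of a link relation to the second coordinate is a link relation for `P`.
    have hsnd : ∀ p q, (∃ x z, r (pairPoint x p) (pairPoint z q)) → p = q := by
      apply hrel
      · refine ⟨?_, ?_, ?_⟩
        · rintro p q ⟨x, z, h⟩
          exact ⟨z, x, hr.symm _ _ h⟩
        · rintro p q ⟨x, z, h⟩ g
          exact ⟨_, _, hmove _ _ _ _ h 1 g⟩
        · rintro p q ⟨x, z, h⟩ g hg
          have h1 := hr.stab _ _ h (toPermutational (SemidirectProduct.inr g))
            (by rw [toPermutational_inr_smul, hg])
          rw [toPermutational_inr_smul] at h1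
          exact ⟨_, _, h1⟩
      · rintro y ⟨x, z, h⟩ hy
        exact (hbase x z y h hy).2
    intro y z h
    obtain ⟨y, p, rfl⟩ := exists_eq_pairPoint y
    obtain ⟨z, q, rfl⟩ := exists_eq_pairPoint z
    obtain rfl := hsnd p q ⟨y, z, h⟩
    obtain ⟨g, hg⟩ := MulAction.exists_smul_eq P.Elem p P'
    have h1 := hmove _ _ _ _ h 1 g
    rw [hg, one_smul, one_smul] at h1
    rw [(hbase _ _ _ h1 hPw).1]

/-- Along the `σ`-cycle from `σ q` back to `q` the value of `f` never changes. -/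
theorem eq_one_of_agree_off_one {Y X : Type*} [Finite Y] (σ : Equiv.Perm Y) (f : Y → X) (q : Y)
    (h : ∀ y, y ≠ q → f (σ y) = f y) : f (σ q) = f q := by
  have hpow : ∀ n : ℕ, 0 < n → (∀ i, 0 < i → i < n → (σ ^ i) q ≠ q) →
      f ((σ ^ n) q) = f (σ q) := by
    intro n hn
    induction n, hn using Nat.le_induction with
    | base => simp
    | succ n hn ih =>
      intro hne
      rw [pow_succ', Equiv.Perm.mul_apply, h _ (hne n hn (by omega))]
      exact ih fun i h1 h2 => hne i h1 (by omega)
  have hper : ∃ n, 0 < n ∧ (σ ^ n) q = q :=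
    ⟨orderOf σ, orderOf_pos σ, by simp [pow_orderOf_eq_one]⟩
  classical
  have h1 := hpow (Nat.find hper) (Nat.find_spec hper).1
    fun i h1 h2 h3 => Nat.find_min hper h2 ⟨h1, h3⟩
  rw [(Nat.find_spec hper).2] at h1
  exact h1.symm

/-- The point `w` is the constant function `c`, fixed by every `inr`. The point `P` marks one
representative of each cycle of `v t₀` with `e`, so its cycle under `v t₀` has the full length
`orderOf σ`. -/
theorem separating_exponentiation [Finite A.Elem] [MulAction.IsPretransitive A.Elem A.Point]
    [MulAction.IsPretransitive P.Elem P.Point] [Finite P.Point] [Nontrivial P.Point]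
    (hst : ∃ x y : A.Point, MulAction.stabilizer A.Elem x ≠ MulAction.stabilizer A.Elem y)
    (v : τ → P.Elem) (t₀ : τ) :
    Separating (Ω := (exponentiation A P).Point)
      (fun t => toExponentiation (SemidirectProduct.inr (v t) : Wreath A P)) t₀ := by
  classical
  obtain ⟨c, e, hce⟩ := hst
  obtain ⟨s, hsc, hse⟩ := exists_smul_eq_and_smul_ne hce
  have hne : e ≠ c := fun h => hce (by rw [h])
  have hsec : s • e ≠ c := fun h => hne (MulAction.injective s (h.trans hsc.symm))
  -- The constant function `s • e` differs both from the constant `c` and from `f`, even if `σ = 1`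
  -- and `f` is the constant `e`; moving `c` to `e` would fail there.
  obtain ⟨a, ha⟩ := MulAction.exists_smul_eq A.Elem c (s • e)
  let σ : Equiv.Perm P.Point := MulAction.toPerm (v t₀)
  have hσ : ∀ (i : ℕ) (q : P.Point), (v t₀ ^ i)⁻¹ • q = (σ ^ i)⁻¹ q := by
    intro i q
    rw [Equiv.Perm.eq_inv_iff_eq]
    have : σ ^ i = MulAction.toPerm (v t₀ ^ i) :=
      (map_pow (MulAction.toPermHom P.Elem P.Point) (v t₀) i).symm
    rw [this, MulAction.toPerm_apply, smul_inv_smul]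
  let rep : P.Point → P.Point := fun q => (Quotient.mk (Equiv.Perm.SameCycle.setoid σ) q).out
  have hrep : ∀ q, σ.SameCycle (rep q) q := fun q => Quotient.mk_out
    (s := Equiv.Perm.SameCycle.setoid σ) q
  have hrep' : ∀ q q', σ.SameCycle q q' → rep q = rep q' := fun q q' h =>
    congrArg Quotient.out (Quotient.sound (s := Equiv.Perm.SameCycle.setoid σ) h)
  let f : P.Point → A.Point := fun q => if rep q = q then e else c
  have hf : ∀ q, rep q = q → f q = e := fun q h => if_pos h
  have hf' : ∀ q, rep q ≠ q → f q = c := fun q h => if_neg h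
  -- Under the hypothesis representatives go to representatives of the same cycle, so `σ ^ i` fixes
  -- a point of each cycle and is trivial.
  have hpowrep : ∀ i : ℕ, (∀ q, rep q = q → f ((σ ^ i)⁻¹ q) ≠ c) → σ ^ i = 1 := by
    intro i h
    ext q
    rw [Equiv.Perm.one_apply]
    have hrr : rep (rep q) = rep q := hrep' _ _ (hrep q)
    have h1 : rep ((σ ^ i)⁻¹ (rep q)) = (σ ^ i)⁻¹ (rep q) := by
      by_contra h2
      exact h _ hrr (hf' _ h2)
    have h2 : rep ((σ ^ i)⁻¹ (rep q)) = rep (rep q) := by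
      apply hrep'
      rw [← zpow_natCast, ← zpow_neg]
      exact (Equiv.Perm.sameCycle_zpow_left).2 (Equiv.Perm.SameCycle.refl _ _)
    rw [h1, hrr, Equiv.Perm.inv_eq_iff_eq] at h2
    obtain ⟨j, hj⟩ := hrep q
    rw [← hj, ← Equiv.Perm.mul_apply, ← zpow_natCast, ← zpow_add, add_comm, zpow_add,
      zpow_natCast, Equiv.Perm.mul_apply, ← h2]
  obtain ⟨q₀⟩ : Nonempty P.Point := inferInstance
  have hr0 : rep (rep q₀) = rep q₀ := hrep' _ _ (hrep q₀)
  have hf0 : f (rep q₀) = e := hf _ hr0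
  have hpow : ∀ (i : ℕ) (f : P.Point → A.Point),
      toExponentiation (SemidirectProduct.inr (v t₀) : Wreath A P) ^ i • funPoint f =
        funPoint fun q => f ((σ ^ i)⁻¹ q) := by
    intro i f
    rw [toExponentiation_inr_pow, toExponentiation_inr_smul]
    simp only [hσ]
  refine ⟨funPoint fun _ => c, funPoint f, toExponentiation (SemidirectProduct.inl fun _ => a),
    orderOf σ, ?_, ?_, ?_, ?_, ?_, orderOf_pos σ, ?_, ?_, ?_⟩
  · intro t
    rw [toExponentiation_inr_smul]
  · intro t
    exact commute_inl_const_inr a (v t)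
  · rw [toExponentiation_inl_smul, ne_eq, funPoint_inj]
    exact fun h => hsec (ha.symm.trans (congrFun h q₀))
  · rw [toExponentiation_inl_smul, ne_eq, funPoint_inj]
    exact fun h => hse (ha.symm.trans ((congrFun h (rep q₀)).trans hf0))
  · rw [ne_eq, funPoint_inj]
    exact fun h => hne (hf0.symm.trans (congrFun h _))
  · refine forall_point_exponentiation fun y => ?_
    rw [hpow, pow_orderOf_eq_one]
    rfl
  · intro i h1 h2 h
    rw [hpow, funPoint_inj] at h
    refine pow_ne_one_of_lt_orderOf h1.ne' h2 (hpowrep i fun q hq => ?_)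
    rw [congrFun h q, hf q hq]
    exact hne
  · intro r hr hrel
    refine forall_point_exponentiation fun y => forall_point_exponentiation fun z h => ?_
    have caseA : ∀ z, r (funPoint f) (funPoint z) →
        (∀ q, MulAction.stabilizer A.Elem (f q) = MulAction.stabilizer A.Elem (z q)) → z = f := by
      intro z h hz
      obtain ⟨i, hi⟩ := hrel _ h (by
        rw [ne_eq, funPoint_inj]
        intro h1
        have h2 := hz (rep q₀)
        rw [hf0, h1] at h2
        exact hce h2.symm)
      rw [hpow, funPoint_inj] at hi
      have h1 : σ ^ i = 1 := by
        refine hpowrep i fun q hq h2 => ?_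
        have h3 := hz q
        rw [hf q hq, ← congrFun hi q, h2] at h3
        exact hce h3.symm
      rw [← hi, h1]
      rfl
    have caseB : ∀ z q, q ≠ rep q₀ → r (funPoint f) (funPoint z) →
        (∀ y, y ≠ q → z y = f y) → z = f := by
      intro z q hq h hz
      obtain ⟨i, hi⟩ := hrel _ h (by
        rw [ne_eq, funPoint_inj]
        intro h1
        have h2 := hz _ hq.symm
        rw [hf0, h1] at h2
        exact hne h2.symm)
      rw [hpow, funPoint_inj] at hi
      have h1 := eq_one_of_agree_off_one (σ ^ i)⁻¹ f q fun y hy => by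
        rw [← hz y hy, ← hi]
      funext y
      by_cases hy : y = q
      · rw [hy, ← h1, ← hi]
      · exact hz y hy
    rw [funPoint_inj]
    by_cases hst : ∀ q, MulAction.stabilizer A.Elem (y q) = MulAction.stabilizer A.Elem (z q)
    · obtain ⟨b, hb⟩ := exists_inl_smul_funPoint_eq y f
      have h1 := hr.smul _ _ h (toExponentiation (SemidirectProduct.inl b))
      rw [toExponentiation_inl_smul, toExponentiation_inl_smul, funext hb] at h1
      have h2 := caseA _ h1 fun q => by rw [← hb, stabilizer_smul_eq_iff, hst]
      funext q
      exact MulAction.injective (b q) ((hb q).trans (congrFun h2 q).symm)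
    · exfalso
      push Not at hst
      obtain ⟨q, hq⟩ := hst
      obtain ⟨u, huy, huz⟩ := exists_smul_eq_and_smul_ne hq
      -- Acting by `u` in coordinate `q` fixes `y` and links `z` to a function differing from it
      -- only there. The critical coordinate is then moved away from `rep q₀` and `z` to `f`,
      -- contradicting `caseB`.
      have h1 := hr.stab _ _ h
        (toExponentiation (SemidirectProduct.inl (Pi.mulSingle q u)))
        (by
          rw [toExponentiation_inl_smul, funPoint_inj]
          funext q'
          by_cases hq' : q' = q
          · subst hq'; simpa using huy
          · simp [hq'])
      rw [toExponentiation_inl_smul] at h1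
      obtain ⟨q₁, hq₁⟩ := exists_ne (rep q₀)
      obtain ⟨g, hg⟩ := MulAction.exists_smul_eq P.Elem q q₁
      have h2 := hr.smul _ _ h1 (toExponentiation (SemidirectProduct.inr g))
      rw [toExponentiation_inr_smul, toExponentiation_inr_smul] at h2
      obtain ⟨b, hb⟩ := exists_inl_smul_funPoint_eq (fun q => z (g⁻¹ • q)) f
      have h3 := hr.smul _ _ h2 (toExponentiation (SemidirectProduct.inl b))
      rw [toExponentiation_inl_smul, toExponentiation_inl_smul, funext hb] at h3
      have h4 := caseB _ q₁ hq₁ h3 (by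
        intro y hy
        have hy' : g⁻¹ • y ≠ q := by
          intro h
          rw [inv_smul_eq_iff, hg] at h
          exact hy h
        simpa [hy'] using hb y)
      have h5 := (congrFun h4 q₁).trans (hb q₁).symm
      have h6 := MulAction.injective (b q₁) h5
      have hq₁' : g⁻¹ • q₁ = q := inv_smul_eq_iff.2 hg.symm
      simp only [hq₁', Pi.mulSingle_eq_same] at h6
      exact huz h6

/-! ### One step of the iteration. -/

section Step

variable {ι τ : Type*} {A P : PermGroup}

theorem finite_wreath_point (κ : Kind) [Finite A.Point] [Finite P.Point] :
    Finite (wreath κ A P).Point := by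
  cases κ
  · exact inferInstanceAs (Finite (A.Point × P.Point))
  · exact inferInstanceAs (Finite (P.Point → A.Point))

theorem nontrivial_wreath_point (κ : Kind) [Nontrivial A.Point] [Nontrivial P.Point] :
    Nontrivial (wreath κ A P).Point := by
  cases κ
  · exact inferInstanceAs (Nontrivial (A.Point × P.Point))
  · exact inferInstanceAs (Nontrivial (P.Point → A.Point))

theorem isPretransitive_wreath (κ : Kind) [MulAction.IsPretransitive A.Elem A.Point]
    [MulAction.IsPretransitive P.Elem P.Point] :
    MulAction.IsPretransitive (wreath κ A P).Elem (wreath κ A P).Point := by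
  cases κ
  · exact isPretransitive_permutational
  · exact isPretransitive_exponentiation

theorem eq_inr_of_left_eq_one {F : P.Point → A.Elem} (hF : F = 1) (g : P.Elem) :
    (⟨F, g⟩ : Wreath A P) = SemidirectProduct.inr g := by
  rw [hF]
  rfl

theorem exists_wreath_lift_of_directed (κ : Kind) [Finite A.Elem] [Nontrivial A.Point]
    [MulAction.IsPretransitive A.Elem A.Point] [Finite P.Point] [Nontrivial P.Point]
    [MulAction.IsPretransitive P.Elem P.Point] (hA : Group.IsPerfect A.Elem)
    (hst : ∃ x y : A.Point, MulAction.stabilizer A.Elem x ≠ MulAction.stabilizer A.Elem y)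
    (x : ι → P.Elem) (hx : Subgroup.closure (Set.range x) = ⊤) (idx : τ → ι)
    (hidx : Function.Injective idx) (b : τ → A.Elem) (hb : Subgroup.closure (Set.range b) = ⊤)
    (hdir : Directed (Ω := P.Point) (fun t => x (idx t))) :
    ∃ x' : ι → (wreath κ A P).Elem, Subgroup.closure (Set.range x') = ⊤ ∧
      (∀ i, wreathProj κ A P (x' i) = x i) ∧
      (κ = .permutational → Directed (Ω := (wreath κ A P).Point) (fun t => x' (idx t))) ∧
      (κ = .exponentiation → ∀ (idx' : τ → ι) (t₀ : τ), (∀ t, idx' t ∉ Set.range idx) →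
        Separating (Ω := (wreath κ A P).Point) (fun t => x' (idx' t)) t₀) := by
  obtain ⟨F, q, hF, hq, hcl⟩ := exists_lift_of_directed hA x hx idx hidx b hb hdir
  cases κ
  · refine ⟨fun i => toPermutational ⟨F i, x i⟩, hcl, fun i => rfl, fun _ => ?_, nofun⟩
    exact directed_permutational (fun t => ⟨F (idx t), x (idx t)⟩) q
      (fun t => (hq t).1) (fun t => (hq t).2)
  · refine ⟨fun i => toExponentiation ⟨F i, x i⟩, hcl, fun i => rfl, nofun, fun _ => ?_⟩
    intro idx' t₀ hidx'
    have := separating_exponentiation hst (fun t => x (idx' t)) t₀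
    simp only [eq_inr_of_left_eq_one (hF _ (hidx' _))]
    exact this

theorem exists_wreath_lift_of_separating (κ : Kind) [Finite A.Elem] [Nontrivial A.Point]
    [MulAction.IsPretransitive A.Elem A.Point] [Finite P.Point] [Nontrivial P.Point]
    [MulAction.IsPretransitive P.Elem P.Point] (hA : Group.IsPerfect A.Elem)
    (hst : ∃ x y : A.Point, MulAction.stabilizer A.Elem x ≠ MulAction.stabilizer A.Elem y)
    (x : ι → P.Elem) (hx : Subgroup.closure (Set.range x) = ⊤) (idx : τ → ι)
    (hidx : Function.Injective idx) (b : τ → A.Elem) (hb : Subgroup.closure (Set.range b) = ⊤)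
    (t₀ : τ) (hsep : Separating (Ω := P.Point) (fun t => x (idx t)) t₀) :
    ∃ x' : ι → (wreath κ A P).Elem, Subgroup.closure (Set.range x') = ⊤ ∧
      (∀ i, wreathProj κ A P (x' i) = x i) ∧
      ∀ (idx' : τ → ι) (s₀ : τ), (∀ t, idx' t ∉ Set.range idx) →
        (κ = .permutational → Separating (Ω := P.Point) (fun t => x (idx' t)) s₀) →
        Separating (Ω := (wreath κ A P).Point) (fun t => x' (idx' t)) s₀ := by
  obtain ⟨F, hF, hcl⟩ := exists_lift_of_separating hA x hx idx hidx b hb t₀ hsep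
  cases κ
  · refine ⟨fun i => toPermutational ⟨F i, x i⟩, hcl, fun i => rfl, ?_⟩
    intro idx' s₀ hidx' hs
    have := separating_permutational (A := A) _ _ (hs rfl)
    simp only [eq_inr_of_left_eq_one (hF _ (hidx' _))]
    exact this
  · refine ⟨fun i => toExponentiation ⟨F i, x i⟩, hcl, fun i => rfl, ?_⟩
    intro idx' s₀ hidx' _
    have := separating_exponentiation hst (fun t => x (idx' t)) s₀
    simp only [eq_inr_of_left_eq_one (hF _ (hidx' _))]
    exact this

end Step

theorem GeneratedByAtMost.exists_fin {G : Type*} [Group G] {n : ℕ}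
    (h : GeneratedByAtMost G n) : ∃ b : Fin n → G, Subgroup.closure (Set.range b) = ⊤ := by
  obtain ⟨s, hs, hcl⟩ := h
  refine ⟨fun i => if hi : i.1 < s.card then (s.equivFin.symm ⟨i, hi⟩ : G) else 1, ?_⟩
  rw [← top_le_iff, ← hcl]
  apply Subgroup.closure_mono
  intro g hg
  refine ⟨⟨s.equivFin ⟨g, hg⟩, (s.equivFin ⟨g, hg⟩).2.trans_le hs⟩, ?_⟩
  simp

/-! ### Compatible generators of the iterated products and density. -/

section Iterated

variable {r : ℕ → ℕ} {S : (i : ℕ) → Subgroup (Equiv.Perm (Fin (r i)))} {k : ℕ → ℕ}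

theorem finite_iterated_point (S : (i : ℕ) → Subgroup (Equiv.Perm (Fin (r i)))) (k : ℕ → ℕ)
    (n : ℕ) : Finite (iterated S k n).Point := by
  have hfin : ∀ i, Finite (ofSubgroup (S i)).Point := fun i =>
    inferInstanceAs (Finite (Fin (r i)))
  induction n with
  | zero => exact hfin 0
  | succ n ih =>
    have := hfin (n + 1)
    exact finite_wreath_point _

theorem nontrivial_iterated_point (hS : ∀ i, Nontrivial (Fin (r i)))
    (n : ℕ) : Nontrivial (iterated S k n).Point := by
  have hnt : ∀ i, Nontrivial (ofSubgroup (S i)).Point := hS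
  induction n with
  | zero => exact hnt 0
  | succ n ih =>
    have := hnt (n + 1)
    exact nontrivial_wreath_point _

theorem isPretransitive_iterated (hS : ∀ i, MulAction.IsPretransitive (S i) (Fin (r i)))
    (n : ℕ) : MulAction.IsPretransitive (iterated S k n).Elem (iterated S k n).Point := by
  have htr : ∀ i, MulAction.IsPretransitive (ofSubgroup (S i)).Elem (ofSubgroup (S i)).Point := hS
  induction n with
  | zero => exact htr 0
  | succ n ih =>
    have := htr (n + 1)
    exact isPretransitive_wreath _

theorem kindAt_eq_exponentiation {i : ℕ} (h : i ∈ Set.range k) :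
    kindAt k i = .exponentiation := if_pos h

theorem mem_range_of_kindAt_eq {i : ℕ} (h : kindAt k i = .exponentiation) : i ∈ Set.range k := by
  by_contra hi
  rw [kindAt, if_neg hi] at h
  exact nomatch h

/-- The generating tuples of the iterated mixed wreath products that can be lifted: either only
the permutational action has occurred and one of the tuples of length `d` is directed, or the last
exponentiation was at `k a` and the tuples of length `d` not yet used since then are separating. -/
structure Liftable {d m : ℕ} (t₀ : Fin d) (S : (i : ℕ) → Subgroup (Equiv.Perm (Fin (r i))))
    (k : ℕ → ℕ) (n : ℕ) (x : Bool × Fin m × Fin d → (iterated S k n).Elem) : Prop where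
  closure_eq : Subgroup.closure (Set.range x) = ⊤
  liftable : (∃ j : Fin m, Directed (Ω := (iterated S k n).Point) fun t => x (true, j, t)) ∨
    ∃ (c : Bool) (a s : ℕ), n = k a + s ∧ (∀ i, k a < i → i ≤ n → kindAt k i = .permutational) ∧
      ∀ j : Fin m, s ≤ j →
        Separating (Ω := (iterated S k n).Point) (fun t => x (c, j, t)) t₀

theorem exists_liftable_zero {d m : ℕ} (hm : 0 < m) (t₀ : Fin d)
    (hS : ∀ i, Nontrivial (Fin (r i)))
    (h_transitive : ∀ i, MulAction.IsPretransitive (S i) (Fin (r i)))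
    (h_generated : ∀ i, GeneratedByAtMost (S i) d) :
    ∃ x : Bool × Fin m × Fin d → (iterated S k 0).Elem, Liftable t₀ S k 0 x := by
  obtain ⟨b, hb⟩ := (h_generated 0).exists_fin
  have hcl : Subgroup.closure (Set.range fun i : Bool × Fin m × Fin d =>
      if i.1 then (1 : S 0) else b i.2.2) = ⊤ := by
    rw [← top_le_iff, ← hb]
    apply Subgroup.closure_mono
    rintro _ ⟨t, rfl⟩
    exact ⟨(false, ⟨0, hm⟩, t), rfl⟩
  -- The `false` blocks generate `S 0`; the `true` blocks consist of identities, which are directed.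
  refine ⟨fun i => if i.1 then (1 : S 0) else b i.2.2, hcl, Or.inl ⟨⟨0, hm⟩, ?_⟩⟩
  have := nontrivial_iterated_point (S := S) (k := k) hS 0
  have := isPretransitive_iterated (k := k) h_transitive 0
  exact directed_one

theorem Liftable.exists_succ {d m : ℕ} {t₀ : Fin d}
    (hS : ∀ i, Nontrivial (Fin (r i)))
    (h_transitive : ∀ i, MulAction.IsPretransitive (S i) (Fin (r i)))
    (h_perfect : ∀ i, Group.IsPerfect (S i))
    (h_generated : ∀ i, GeneratedByAtMost (S i) d)
    (h_stabilizer : ∀ i, ∃ x y : Fin (r i),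
      MulAction.stabilizer (S i) x ≠ MulAction.stabilizer (S i) y)
    (h_increasing : StrictMono k) (h_stride : ∀ n, k (n + 1) ≤ k n + m) {n : ℕ}
    {x : Bool × Fin m × Fin d → (iterated S k n).Elem} (hx : Liftable t₀ S k n x) :
    ∃ x' : Bool × Fin m × Fin d → (iterated S k (n + 1)).Elem, Liftable t₀ S k (n + 1) x' ∧
      ∀ i, proj S k n (x' i) = x i := by
  have := finite_iterated_point S k n
  have := nontrivial_iterated_point (S := S) (k := k) hS n
  have := isPretransitive_iterated (k := k) h_transitive n
  have : Finite (ofSubgroup (S (n + 1))).Elem := inferInstanceAs (Finite (S (n + 1)))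
  have : Nontrivial (ofSubgroup (S (n + 1))).Point := hS (n + 1)
  have : MulAction.IsPretransitive (ofSubgroup (S (n + 1))).Elem (ofSubgroup (S (n + 1))).Point :=
    h_transitive (n + 1)
  obtain ⟨b, hb⟩ := (h_generated (n + 1)).exists_fin
  have hinj : ∀ (c : Bool) (j : Fin m), Function.Injective
      (fun t : Fin d => ((c, j, t) : Bool × Fin m × Fin d)) := by
    intro c j t t' h
    simpa using h
  obtain ⟨hcl, ⟨j, hdir⟩ | ⟨c, a, s, hn, hperm, hsep⟩⟩ := hx
  · obtain ⟨x', h1, h2, h3, h4⟩ := exists_wreath_lift_of_directed (kindAt k (n + 1))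
      (A := ofSubgroup (S (n + 1))) (h_perfect (n + 1)) (h_stabilizer (n + 1)) x hcl _
      (hinj true j) b hb hdir
    refine ⟨x', ⟨h1, ?_⟩, h2⟩
    cases hκ : kindAt k (n + 1) with
    | permutational => exact Or.inl ⟨j, h3 hκ⟩
    | exponentiation =>
      obtain ⟨a, ha⟩ := mem_range_of_kindAt_eq hκ
      -- At the first exponentiation a `true` block pays for the lift, so all `false` blocks are
      -- lifted trivially and become separating.
      refine Or.inr ⟨false, a, 0, by omega, fun i hi hi' => by omega, fun j' _ => ?_⟩
      exact h4 hκ (fun t => (false, j', t)) t₀ (by simp)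
  -- If all `m` blocks were used up, the next exponentiation `k (a + 1) ≤ k a + m` would already
  -- have occurred.
  · have hs : s < m := by
      by_contra hs
      have h1 := h_stride a
      have h2 := hperm (k (a + 1)) (h_increasing (Nat.lt_succ_self a)) (by omega)
      rw [kindAt_eq_exponentiation ⟨a + 1, rfl⟩] at h2
      exact nomatch h2
    obtain ⟨x', h1, h2, h3⟩ := exists_wreath_lift_of_separating (kindAt k (n + 1))
      (A := ofSubgroup (S (n + 1))) (h_perfect (n + 1)) (h_stabilizer (n + 1)) x hcl _
      (hinj c ⟨s, hs⟩) b hb t₀ (hsep ⟨s, hs⟩ le_rfl)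
    refine ⟨x', ⟨h1, Or.inr ?_⟩, h2⟩
    cases hκ : kindAt k (n + 1) with
    | permutational =>
      refine ⟨c, a, s + 1, by omega, fun i hi hi' => ?_, fun j hj => ?_⟩
      · rcases Nat.lt_or_ge n i with h | h
        · rwa [show i = n + 1 by omega]
        · exact hperm i hi h
      · refine h3 (fun t => (c, j, t)) t₀ ?_ fun _ => hsep j (by omega)
        rintro t ⟨t', h⟩
        have h4 : (⟨s, hs⟩ : Fin m) = j := congrArg (fun z => z.2.1) h
        rw [← h4] at hj
        exact absurd hj (by simp)
    | exponentiation =>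
      obtain ⟨a', ha'⟩ := mem_range_of_kindAt_eq hκ
      -- The lift used a block of colour `c`, so all `m` blocks of the other colour are lifted
      -- trivially and start afresh.
      refine ⟨!c, a', 0, by omega, fun i hi hi' => by omega, fun j _ => ?_⟩
      exact h3 (fun t => (!c, j, t)) t₀ (by simp) (by rw [hκ]; nofun)

/-- Elements of the inverse limit generate a dense subgroup as soon as their images generate
each of the groups of the inverse system. -/
theorem dense_closure_of_forall (s : Set (infinite S k))
    (h : ∀ n, Subgroup.closure ((fun g : infinite S k => g.1 n) '' s) = ⊤) :
    Dense (Subgroup.closure s : Set (infinite S k)) := by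
  intro g
  rw [mem_closure_iff_nhds]
  intro U hU
  obtain ⟨V, hV, hVU⟩ := mem_nhds_induced _ _ _ |>.1 hU
  rw [nhds_pi, Filter.mem_pi] at hV
  obtain ⟨I, hI, t, ht, htV⟩ := hV
  -- A basic neighbourhood involves finitely many levels, and the level `N` above them determines
  -- all lower ones.
  obtain ⟨N, hN⟩ := hI.bddAbove
  let ev : infinite S k →* (iterated S k N).Elem :=
    (Pi.evalMonoidHom (fun i => (iterated S k i).Elem) N).comp (infinite S k).subtype
  have hev : (Subgroup.closure s).map ev = ⊤ := by
    rw [MonoidHom.map_closure]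
    exact h N
  have hg : g.1 N ∈ (Subgroup.closure s).map ev := by rw [hev]; trivial
  obtain ⟨g', hg', hgN⟩ := hg
  have hagree : ∀ j, ∀ i, i + j = N → g'.1 i = g.1 i := by
    intro j
    induction j with
    | zero =>
      rintro i rfl
      exact hgN
    | succ j ih =>
      intro i hi
      rw [← g'.2 i, ← g.2 i, ih (i + 1) (by omega)]
  refine ⟨g', hVU (htV fun i hi => ?_), hg'⟩
  rw [hagree (N - i) i (by have := hN hi; omega)]
  exact mem_of_mem_nhds (ht i)

end Iterated

end MixedWreath

theorem theoremB (d m : ℕ) (r : ℕ → ℕ) (S : (i : ℕ) → Subgroup (Equiv.Perm (Fin (r i))))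
    (h_transitive : ∀ i, MulAction.IsPretransitive (S i) (Fin (r i)))
    (h_perfect : ∀ i, Group.IsPerfect (S i))
    (h_generated : ∀ i, MixedWreath.GeneratedByAtMost (S i) d)
    (h_stabilizer : ∀ i, ∃ x y : Fin (r i),
      MulAction.stabilizer (S i) x ≠ MulAction.stabilizer (S i) y)
    (k : ℕ → ℕ) (h_increasing : StrictMono k)
    (h_stride : ∀ n, k (n + 1) ≤ k n + m) :
    MixedWreath.TopologicallyGeneratedByAtMost (MixedWreath.infinite S k) (2 * m * d) := by
  classical
  have hS : ∀ i, Nontrivial (Fin (r i)) := by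
    intro i
    obtain ⟨x, y, h⟩ := h_stabilizer i
    exact ⟨x, y, fun hxy => h (by rw [hxy])⟩
  have hm : 0 < m := by
    have h1 := h_stride 0
    have h2 := h_increasing (Nat.lt_succ_self 0)
    simp only [Nat.succ_eq_add_one] at h2
    omega
  -- For `d = 0` the group `S 0` would be trivial and all stabilizers equal.
  have hd : 0 < d := by
    by_contra hd
    obtain ⟨b, hb⟩ := (h_generated 0).exists_fin
    have : IsEmpty (Fin d) := ⟨fun i => hd (by have := i.2; omega)⟩
    rw [Set.range_eq_empty, Subgroup.closure_empty] at hb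
    obtain ⟨x, y, h⟩ := h_stabilizer 0
    apply h
    ext s
    have hs : s ∈ (⊥ : Subgroup (S 0)) := by rw [hb]; trivial
    rw [Subgroup.mem_bot] at hs
    simp [hs]
  let t₀ : Fin d := ⟨0, hd⟩
  obtain ⟨x₀, hx₀⟩ := MixedWreath.exists_liftable_zero (k := k) hm t₀ hS h_transitive h_generated
  choose next hnext hproj using fun (n : ℕ)
    (x : {x : Bool × Fin m × Fin d → (MixedWreath.iterated S k n).Elem //
        MixedWreath.Liftable t₀ S k n x}) =>
    x.2.exists_succ hS h_transitive h_perfect h_generated h_stabilizer h_increasing h_stride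
  let x : (n : ℕ) →
      {x : Bool × Fin m × Fin d → (MixedWreath.iterated S k n).Elem //
        MixedWreath.Liftable t₀ S k n x} :=
    fun n => Nat.rec ⟨x₀, hx₀⟩ (fun n y => ⟨next n y, hnext n y⟩) n
  let g : Bool × Fin m × Fin d → MixedWreath.infinite S k :=
    fun i => ⟨fun n => (x n).1 i, fun n => hproj n (x n) i⟩
  refine ⟨Finset.univ.image g, ?_, ?_⟩
  · refine Finset.card_image_le.trans ?_
    simp [mul_assoc]
  · apply MixedWreath.dense_closure_of_forall
    intro n
    rw [Finset.coe_image, Finset.coe_univ, Set.image_univ, ← Set.range_comp]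
    exact (x n).2.closure_eq
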